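/- Let $p$ be an odd prime. A commutative ring $R$ of characteristic $p$ is called F-finite if its Frobenius endomorphism $F_R\colon R\to R$, $x\mapsto x^p$, is finite, that is, if $R$ is a finitely generated module over itself via $F_R$. Let $K$ be an algebraically closed field of characteristic $p$, let $X$ be an indeterminate and let $\Omega$ be an algebraic closure of the field of rational functions $K(X)$. Choose for every $c\in K$ one square root $\sqrt{c}\in K$ of $c$, and for every $a\in K$ one square root $\sqrt{(X+a)^3}\in\Omega$ of $(X+a)^3$; the choices are arbitrary, but the chosen value $\sqrt{b^3}$ depends only on the element $b^3$ of $K$. Let $$A=K\Bigl[X,\ \frac{1}{\sqrt{(X+a)^3}+\sqrt{b^3}}\ ;\ a,b\in K,\ b\neq 0\Bigr]\subseteq\Omega .$$ Then $A$ is a Noetherian domain of Krull dimension one, the localization $A_{\mathfrak p}$ is F-finite for every prime ideal $\mathfrak p$ of $A$, and $A$ is not F-finite. In particular, the question of Datta and Murayama has a negative answer in every odd prime characteristic $p$: it is not true that every Noetherian domain $R$ of characteristic $p$, such that $R_{\mathfrak p}$ is F-finite for every prime ideal $\mathfrak p$ of $R$, is F-finite. -/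

import Mathlib

open scoped Polynomial

universe u

/-- A nontrivial commutative ring in which the prime `p` vanishes has characteristic `p`; this is
the case of the localization of a ring of characteristic `p` at a prime ideal. -/
instance Localization.AtPrime.instCharPOfPrime (p : ℕ) [Fact p.Prime] (R : Type u) [CommRing R]
    [CharP R p] (P : Ideal R) [P.IsPrime] : CharP (Localization.AtPrime P) p := by
  have h0 : (p : Localization.AtPrime P) = 0 := by
    rw [← map_natCast (algebraMap R (Localization.AtPrime P)) p, CharP.cast_eq_zero, map_zero]
  exact (CharP.charP_iff_prime_eq_zero Fact.out).2 h0

/-- A commutative ring `R` of prime characteristic `p` is F-finite if its Frobenius endomorphism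
`x ↦ x ^ p` is a finite ring homomorphism. -/
def IsFFinite (p : ℕ) [Fact p.Prime] (R : Type u) [CommRing R] [CharP R p] : Prop :=
  (frobenius R p).Finite

/-- The assertion of the question of Datta and Murayama, in characteristic `p`: every Noetherian
domain of characteristic `p` all of whose localizations at prime ideals are F-finite is itself
F-finite. -/
def DattaMurayamaAssertion (p : ℕ) [Fact p.Prime] : Prop :=
  ∀ (R : Type u) [CommRing R] [IsDomain R] [IsNoetherianRing R] [CharP R p],
    (∀ (P : Ideal R) [P.IsPrime], IsFFinite p (Localization.AtPrime P)) → IsFFinite p R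

/-- An algebraic closure of the field `K(X)` of rational functions; the radicals live here. -/
abbrev RatFuncClosure (K : Type u) [Field K] : Type u :=
  AlgebraicClosure (RatFunc K)

/-- The indeterminate `X`, seen in the algebraic closure of `K(X)`. -/
noncomputable def closureX (K : Type u) [Field K] : RatFuncClosure K :=
  algebraMap (RatFunc K) (RatFuncClosure K) RatFunc.X

/-- The ring `K[X, 1 / (√((X + a) ^ 3) + √(b ^ 3)) ; a, b ∈ K, b ≠ 0]`, where `r a` is the
chosen square root of `(X + a) ^ 3` and `s c` is the chosen square root of `c ∈ K`. -/
noncomputable def radicalRing (K : Type u) [Field K] (s : K → K) (r : K → RatFuncClosure K) :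
    Subalgebra K (RatFuncClosure K) :=
  Algebra.adjoin K
    ({closureX K} ∪
      {y | ∃ a b : K, b ≠ 0 ∧ y = 1 / (r a + algebraMap K (RatFuncClosure K) (s (b ^ 3)))})

/-- The ring above contains `K`, so it has the characteristic of `K`. -/
instance radicalRing.instCharP (p : ℕ) (K : Type u) [Field K] [CharP K p] (s : K → K)
    (r : K → RatFuncClosure K) : CharP (radicalRing K s r) p :=
  charP_of_injective_algebraMap (FaithfulSMul.algebraMap_injective K (radicalRing K s r)) p

/-! ### Square roots in multiquadratic extensions -/

section Multiquadratic

variable {E L ι : Type*} [Field E] [Field L] [Algebra E L] [DecidableEq ι]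

/-! Over `X = -c` a radical `r a` can only take the values `± s ((a - c) ^ 3)`. Inverting every `r a
+ s (b ^ 3)` with `b ≠ 0` removes the minus signs, so exactly one prime survives over each `c`,
generated by `X + c` and `r c` (`IsRadicalAlgebra.eq_span`). Every nonzero prime is of this kind, so
Cohen's theorem gives Noetherianity, and the dimension is at most one.

Write `p = 2m + 1`. At the prime over `c` each `X + a` with `a ≠ c` is a unit and `r a = (r a) ^ p *
(X + a) ^ (-3m)`; hence `X` and `r c` generate the localization over its `p`-th powers.

Globally, finitely many generators involve finitely many radicals. Choose `c` avoiding them all.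
Then `A` lies in `S + S * (r c) ^ p`, where `S` consists of elements built from the other radicals
and regular at the point over `X = -c`. As `(r c) ^ p = (X + c) ^ (3m) * r c`, comparing
coefficients of `r c` makes `X + c` a unit of `S`. This is impossible: by independence of the
radicals (`sqrt_notMem_adjoin`) all signs can be prescribed at once, so a valuation centered at that
point exists (`exists_isCenteredAt`). -/

theorem mem_adjoin_insert_sqrt {F : Finset ι} {b : ι} {ρ : ι → L} {d : ι → E}
    (hρ : ∀ i, ρ i ^ 2 = algebraMap E L (d i)) {z : L}
    (hz : z ∈ Algebra.adjoin E (ρ '' (insert b F : Finset ι))) :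
    ∃ v ∈ Algebra.adjoin E (ρ '' F), ∃ w ∈ Algebra.adjoin E (ρ '' F), z = v + w * ρ b := by
  induction hz using Algebra.adjoin_induction with
  | mem z hz =>
    obtain ⟨i, hi, rfl⟩ := hz
    rcases Finset.mem_insert.1 hi with rfl | hi
    · exact ⟨0, zero_mem _, 1, one_mem _, by ring⟩
    · exact ⟨ρ i, Algebra.subset_adjoin ⟨i, hi, rfl⟩, 0, zero_mem _, by ring⟩
  | algebraMap k => exact ⟨_, Subalgebra.algebraMap_mem _ k, 0, zero_mem _, by ring⟩
  | add z z' _ _ h h' =>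
    obtain ⟨v, hv, w, hw, rfl⟩ := h
    obtain ⟨v', hv', w', hw', rfl⟩ := h'
    exact ⟨v + v', add_mem hv hv', w + w', add_mem hw hw', by ring⟩
  | mul z z' _ _ h h' =>
    obtain ⟨v, hv, w, hw, rfl⟩ := h
    obtain ⟨v', hv', w', hw', rfl⟩ := h'
    refine ⟨v * v' + w * w' * algebraMap E L (d b), ?_, v * w' + w * v', ?_, ?_⟩
    · exact add_mem (mul_mem hv hv') (mul_mem (mul_mem hw hw') (Subalgebra.algebraMap_mem _ _))
    · exact add_mem (mul_mem hv hw') (mul_mem hw hv')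
    · rw [← hρ]; ring

/-- An element of `E` that becomes a square in a multiquadratic extension of `E` is already a
square up to a product of the adjoined radicands. -/
theorem exists_mul_prod_eq_sq [Algebra.IsAlgebraic E L] (h2 : (2 : L) ≠ 0)
    {ρ : ι → L} {d : ι → E} (hρ : ∀ i, ρ i ^ 2 = algebraMap E L (d i)) (F : Finset ι) :
    ∀ {g : E} {z : L}, z ∈ Algebra.adjoin E (ρ '' F) → z ^ 2 = algebraMap E L g →
      ∃ G ⊆ F, ∃ h : E, g * ∏ i ∈ G, d i = h ^ 2 := by
  induction F using Finset.induction_on with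
  | empty =>
    intro g z hz hg
    simp only [Finset.coe_empty, Set.image_empty, Algebra.adjoin_empty] at hz
    obtain ⟨h, rfl⟩ := Algebra.mem_bot.1 hz
    refine ⟨∅, subset_rfl, h, (algebraMap E L).injective ?_⟩
    simp [← hg]
  | insert b F hb ih =>
    intro g z hz hg
    obtain ⟨v, hv, w, hw, rfl⟩ := mem_adjoin_insert_sqrt hρ hz
    by_cases hbF : ρ b ∈ Algebra.adjoin E (ρ '' F)
    · obtain ⟨G, hG, h, hh⟩ := ih (add_mem hv (mul_mem hw hbF)) hg
      exact ⟨G, hG.trans (Finset.subset_insert _ _), h, hh⟩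
    -- Squaring `v + w * ρ b` gives the cross term `2 * v * w * ρ b`; if `v * w ≠ 0`, this expresses
    -- `ρ b` in the smaller algebra, which is a field by algebraicity.
    have hvw : v * w = 0 := by
      by_contra hne
      refine hbF ?_
      have hinv : (2 * (v * w))⁻¹ ∈ Algebra.adjoin E (ρ '' F) :=
        Subalgebra.inv_mem_of_algebraic _
          (x := ⟨2 * (v * w), mul_mem (ofNat_mem _ 2) (mul_mem hv hw)⟩)
          (Algebra.IsAlgebraic.isAlgebraic _)
      have : ρ b = (algebraMap E L g - v ^ 2 - w ^ 2 * algebraMap E L (d b)) *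
          (2 * (v * w))⁻¹ := by
        rw [eq_mul_inv_iff_mul_eq₀ (mul_ne_zero h2 hne), ← hg, ← hρ]; ring
      rw [this]
      refine mul_mem (sub_mem (sub_mem ?_ (pow_mem hv 2)) (mul_mem (pow_mem hw 2) ?_)) hinv <;>
        exact Subalgebra.algebraMap_mem _ _
    rcases mul_eq_zero.1 hvw with rfl | rfl
    · have : (w * algebraMap E L (d b)) ^ 2 = algebraMap E L (g * d b) := by
        rw [map_mul, ← hg, ← hρ]; ring
      obtain ⟨G, hG, h, hh⟩ := ih (mul_mem hw (Subalgebra.algebraMap_mem _ _)) this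
      refine ⟨insert b G, Finset.insert_subset_insert _ hG, h, ?_⟩
      rw [Finset.prod_insert (fun h => hb (hG h)), ← hh]; ring
    · obtain ⟨G, hG, h, hh⟩ := ih hv (by simpa using hg)
      exact ⟨G, hG.trans (Finset.subset_insert _ _), h, hh⟩

end Multiquadratic

/-- A square root lying outside of an intermediate field of a normal extension can be sent to its
negative by an automorphism over that field. -/
theorem exists_algEquiv_apply_eq_neg {E L : Type*} [Field E] [Field L] [Algebra E L]
    [Normal E L] (M : IntermediateField E L) {ρ : L} (hρ : ρ ∉ M) (hρ2 : ρ ^ 2 ∈ M) :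
    ∃ σ : L ≃ₐ[M] L, σ ρ = -ρ := by
  have hirr : Irreducible (Polynomial.X ^ 2 - Polynomial.C (⟨ρ ^ 2, hρ2⟩ : M)) := by
    refine X_pow_sub_C_irreducible_of_prime Nat.prime_two fun b hb => hρ ?_
    have h := congrArg (algebraMap M L) hb
    rw [map_pow] at h
    rcases sq_eq_sq_iff_eq_or_eq_neg.1 (show (algebraMap M L b) ^ 2 = ρ ^ 2 from h) with h | h
    · rw [← h]; exact b.2
    · rw [← neg_neg ρ, ← h]; exact neg_mem b.2
  have hm := Polynomial.monic_X_pow_sub_C (⟨ρ ^ 2, hρ2⟩ : M) two_ne_zero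
  have key (τ : L) (hτ : τ ^ 2 = ρ ^ 2) :
      Polynomial.X ^ 2 - Polynomial.C (⟨ρ ^ 2, hρ2⟩ : M) = minpoly M τ :=
    minpoly.eq_of_irreducible_of_monic hirr (by
      rw [map_sub, map_pow, Polynomial.aeval_X, Polynomial.aeval_C, hτ]
      exact sub_self _) hm
  have : Normal M L := Normal.tower_top_of_normal E M L
  obtain ⟨σ, hσ⟩ := isConjRoot_iff_exists_algEquiv.1
    (show IsConjRoot M (-ρ) ρ from (key _ (by ring)).symm.trans (key _ rfl))
  exact ⟨σ, hσ⟩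

/-- The left side has a root of odd multiplicity 3 at `-c`, while a square has even multiplicity;
`h` is a polynomial because `K[X]` is integrally closed. -/
theorem mul_prod_ne_sq_ratFunc {K : Type u} [Field K] {c : K} {G : Finset K} (hc : c ∉ G)
    (h : RatFunc K) :
    (RatFunc.X + RatFunc.C c) ^ 3 * ∏ a ∈ G, (RatFunc.X + RatFunc.C a) ^ 3 ≠ h ^ 2 := by
  intro hh
  set f : K[X] := (.X + .C c) ^ 3 * ∏ a ∈ G, (.X + .C a) ^ 3 with hf
  have hfh : algebraMap K[X] (RatFunc K) f = h ^ 2 := by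
    rw [← hh, hf]; simp [map_prod]
  obtain ⟨q, rfl⟩ := IsIntegrallyClosed.exists_algebraMap_eq_of_isIntegral_pow (R := K[X])
    (x := h) two_pos (hfh ▸ isIntegral_algebraMap)
  rw [← map_pow] at hfh
  have hfq : f = q ^ 2 := RatFunc.algebraMap_injective K hfh
  have hne (a : K) : (.X + .C a : K[X]) ≠ 0 := Polynomial.X_add_C_ne_zero a
  have hf0 : f ≠ 0 := mul_ne_zero (pow_ne_zero _ (hne c))
    (Finset.prod_ne_zero_iff.2 fun a _ => pow_ne_zero _ (hne a))
  have hq0 : q ≠ 0 := by rintro rfl; exact hf0 (by simpa using hfq)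
  have h1 : f.rootMultiplicity (-c) = 3 := by
    rw [hf, Polynomial.rootMultiplicity_mul hf0]
    have e1 : ((.X + .C c : K[X]) ^ 3).rootMultiplicity (-c) = 3 := by
      have := Polynomial.rootMultiplicity_X_sub_C_pow (-c) 3
      rwa [Polynomial.C_neg, sub_neg_eq_add] at this
    have e2 : (∏ a ∈ G, (.X + .C a : K[X]) ^ 3).rootMultiplicity (-c) = 0 := by
      refine Polynomial.rootMultiplicity_eq_zero ?_
      rw [Polynomial.IsRoot, Polynomial.eval_prod, Finset.prod_eq_zero_iff]
      rintro ⟨a, ha, h0⟩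
      have h0 : -c + a = 0 := by simpa using h0
      exact hc (by rwa [show c = a from (eq_of_sub_eq_zero (by linear_combination h0)).symm])
    rw [e1, e2]
  rw [hfq, sq, Polynomial.rootMultiplicity_mul (mul_ne_zero hq0 hq0)] at h1
  omega

/-! ### Valuations centered at the chosen point -/

section

variable {K : Type u} [Field K] {s : K → K} {r : K → RatFuncClosure K}

theorem algebraMap_ratFunc_X_add_C (a : K) :
    algebraMap (RatFunc K) (RatFuncClosure K) (RatFunc.X + RatFunc.C a) =
      closureX K + algebraMap K (RatFuncClosure K) a := by
  rw [map_add, closureX, IsScalarTower.algebraMap_apply K (RatFunc K) (RatFuncClosure K),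
    RatFunc.algebraMap_eq_C]

theorem sqrt_notMem_adjoin (h2 : (2 : K) ≠ 0)
    (hr : ∀ a : K, r a ^ 2 = (closureX K + algebraMap K (RatFuncClosure K) a) ^ 3)
    {F : Finset K} {c : K} (hc : c ∉ F) :
    r c ∉ IntermediateField.adjoin (RatFunc K) (r '' F) := by
  classical
  have hr' (a : K) : r a ^ 2 = algebraMap (RatFunc K) (RatFuncClosure K)
      ((RatFunc.X + RatFunc.C a) ^ 3) := by
    rw [map_pow, algebraMap_ratFunc_X_add_C, hr]
  intro hmem
  rw [← IntermediateField.mem_toSubalgebra, IntermediateField.adjoin_toSubalgebra_of_isAlgebraic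
    (fun x _ => Algebra.IsAlgebraic.isAlgebraic x)] at hmem
  have h2' : (2 : RatFuncClosure K) ≠ 0 := by
    have := (map_ne_zero (algebraMap K (RatFuncClosure K))).2 h2
    rwa [map_ofNat] at this
  obtain ⟨G, hG, h, hh⟩ := exists_mul_prod_eq_sq h2' hr' F hmem (hr' c)
  exact mul_prod_ne_sq_ratFunc (fun h => hc (hG h)) h hh

theorem closureX_add_ne_zero (a : K) : closureX K + algebraMap K (RatFuncClosure K) a ≠ 0 := by
  rw [← algebraMap_ratFunc_X_add_C, map_ne_zero, ← RatFunc.algebraMap_X, ← RatFunc.algebraMap_C,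
    ← map_add]
  exact RatFunc.algebraMap_ne_zero (Polynomial.X_add_C_ne_zero a)

/-- A valuation on the algebraic closure of `K(X)`, nonnegative on `K`, whose center on
`K[X, √((X + a) ^ 3) ; a ∈ F]` is the point over `X = -c` at which every `√((X + a) ^ 3)` takes
the value `√((a - c) ^ 3)`. -/
structure IsCenteredAt (s : K → K) (r : K → RatFuncClosure K) (c : K) (F : Finset K)
    {Γ : Type*} [LinearOrderedCommGroupWithZero Γ] (V : Valuation (RatFuncClosure K) Γ) :
    Prop where
  le_one (k : K) : V (algebraMap K (RatFuncClosure K) k) ≤ 1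
  add_lt_one : V (closureX K + algebraMap K (RatFuncClosure K) c) < 1
  sub_lt_one (a : K) : a ∈ F → V (r a - algebraMap K (RatFuncClosure K) (s ((a - c) ^ 3))) < 1

theorem transcendental_closureX : Transcendental K (closureX K) := by
  rw [closureX, transcendental_algebraMap_iff (algebraMap (RatFunc K) (RatFuncClosure K)).injective]
  exact RatFunc.transcendental_X

/-- `X + c` is not a unit of `K[X]`, so some valuation ring of the closure contains `K[X]` and has
`X + c` among its nonunits. -/
theorem exists_valuation_lt_one (c : K) :
    ∃ (Γ : Type u) (_ : LinearOrderedCommGroupWithZero Γ) (V : Valuation (RatFuncClosure K) Γ),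
      (∀ k : K, V (algebraMap K (RatFuncClosure K) k) ≤ 1) ∧
      V (closureX K + algebraMap K (RatFuncClosure K) c) < 1 := by
  let φ : K[X] →ₐ[K] RatFuncClosure K := Polynomial.aeval (closureX K)
  have hφ : Function.Injective φ := transcendental_iff_injective.1 transcendental_closureX
  let R : Subring (RatFuncClosure K) := φ.toRingHom.range
  let t : R := φ.toRingHom.rangeRestrict (.X + .C c)
  have ht : (t : RatFuncClosure K) = closureX K + algebraMap K (RatFuncClosure K) c := by
    change φ (.X + .C c) = _
    simp [φ]
  have hI : Ideal.span {t} ≠ ⊤ := by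
    rw [Ne, Ideal.span_singleton_eq_top]
    intro hu
    obtain ⟨⟨_, q, rfl⟩, hq⟩ := isUnit_iff_exists_inv.1 hu
    have h1 : φ ((.X + .C c) * q) = φ 1 := by
      rw [map_mul, map_one]
      exact congrArg Subtype.val hq
    have h2 := congrArg (Polynomial.eval (-c)) (hφ h1)
    simp at h2
  obtain ⟨W, hW, hW'⟩ := Ideal.image_subset_nonunits_valuationSubring _ hI
  refine ⟨_, _, W.valuation, fun k => ?_, ?_⟩
  · refine (W.valuation_le_one_iff _).2 (hW ⟨.C k, ?_⟩)
    change φ (.C k) = _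
    simp [φ]
  · rw [← ht]
    exact (ValuationSubring.mem_nonunits_iff W).1 (hW' ⟨t, Ideal.mem_span_singleton_self t, rfl⟩)

/-- Signs are corrected one radical at a time: a valuation with the wrong sign at `a` is composed
with an automorphism that negates `r a` and fixes the earlier radicals. -/
theorem exists_isCenteredAt (h2 : (2 : K) ≠ 0) (hs : ∀ c : K, s c ^ 2 = c)
    (hr : ∀ a : K, r a ^ 2 = (closureX K + algebraMap K (RatFuncClosure K) a) ^ 3)
    (c : K) (F : Finset K) :
    ∃ (Γ : Type u) (_ : LinearOrderedCommGroupWithZero Γ) (V : Valuation (RatFuncClosure K) Γ),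
      IsCenteredAt s r c F V := by
  classical
  induction F using Finset.induction_on with
  | empty =>
    obtain ⟨Γ, i, V, h1, h2⟩ := exists_valuation_lt_one c
    exact ⟨Γ, i, V, h1, h2, by simp⟩
  | insert a F ha ih =>
    obtain ⟨Γ, i, V, hV⟩ := ih
    set ι := algebraMap K (RatFuncClosure K) with hι
    set β := ι (s ((a - c) ^ 3)) with hβ
    have hβ2 : β ^ 2 = (ι (a - c)) ^ 3 := by rw [hβ, ← map_pow, hs, map_pow]
    have hprod : V (r a - β) * V (r a + β) < 1 := by
      set t := closureX K + ι c with ht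
      have e : (r a - β) * (r a + β) = t * (t ^ 2 + 3 * t * ι (a - c) + 3 * ι (a - c) ^ 2) := by
        have : closureX K + ι a = t + ι (a - c) := by rw [ht, map_sub]; ring
        calc _ = r a ^ 2 - β ^ 2 := by ring
          _ = _ := by rw [hβ2, hr, this]; ring
      have h3 : V 3 ≤ 1 := by have := hV.le_one 3; rwa [map_ofNat] at this
      have ht1 : V t < 1 := hV.add_lt_one
      have hk : V (ι (a - c)) ≤ 1 := hV.le_one _
      rw [← map_mul, e, map_mul]
      refine mul_lt_one_of_lt_of_le ht1 (V.map_add_le (V.map_add_le ?_ ?_) ?_)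
      · rw [map_pow]; exact pow_le_one₀ zero_le ht1.le
      · rw [map_mul, map_mul]; exact mul_le_one' (mul_le_one' h3 ht1.le) hk
      · rw [map_mul, map_pow]; exact mul_le_one' h3 (pow_le_one₀ zero_le hk)
    by_cases hlt : V (r a - β) < 1
    · refine ⟨Γ, i, V, hV.le_one, hV.add_lt_one, fun b hb => ?_⟩
      rcases Finset.mem_insert.1 hb with rfl | hb
      · exact hlt
      · exact hV.sub_lt_one b hb
    · have hlt' : V (r a + β) < 1 := by
        by_contra hge
        exact absurd hprod (not_lt.2 (one_le_mul (not_lt.1 hlt) (not_lt.1 hge)))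
      let M := IntermediateField.adjoin (RatFunc K) (r '' F)
      have hbase (y : RatFunc K) : algebraMap _ (RatFuncClosure K) y ∈ M := M.algebraMap_mem y
      have hX : closureX K ∈ M := hbase RatFunc.X
      obtain ⟨σ, hσ⟩ := exists_algEquiv_apply_eq_neg M (sqrt_notMem_adjoin h2 hr ha) (by
        rw [hr, ← algebraMap_ratFunc_X_add_C]; exact pow_mem (hbase _) 3)
      have hfix {y : RatFuncClosure K} (hy : y ∈ M) : σ y = y := σ.commutes ⟨y, hy⟩
      have hK (k : K) : ι k ∈ M := by
        rw [hι, IsScalarTower.algebraMap_apply K (RatFunc K) (RatFuncClosure K)]; exact hbase _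
      refine ⟨Γ, i, V.comap (σ : RatFuncClosure K →+* RatFuncClosure K), fun k => ?_, ?_,
        fun b hb => ?_⟩
      · change V (σ (ι k)) ≤ 1
        rw [hfix (hK k)]; exact hV.le_one k
      · change V (σ (closureX K + ι c)) < 1
        rw [hfix (add_mem hX (hK c))]; exact hV.add_lt_one
      · rcases Finset.mem_insert.1 hb with rfl | hb
        · change V (σ (r b - β)) < 1
          rw [map_sub, hσ, hfix (hK _), ← V.map_neg]
          convert hlt' using 2; ring
        · change V (σ (r b - ι (s ((b - c) ^ 3)))) < 1
          rw [map_sub, hfix (hK _), hfix (IntermediateField.subset_adjoin _ _ ⟨b, hb, rfl⟩)]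
          exact hV.sub_lt_one b hb

end

/-! ### Regular elements, and failure of F-finiteness -/

section Center

variable {K : Type u} [Field K] {s : K → K} {r : K → RatFuncClosure K}

theorem Valuation.map_algebraMap_eq_one {K L Γ : Type*} [Field K] [Field L] [Algebra K L]
    [LinearOrderedCommGroupWithZero Γ] {V : Valuation L Γ}
    (hV : ∀ k : K, V (algebraMap K L k) ≤ 1) {k : K} (hk : k ≠ 0) : V (algebraMap K L k) = 1 := by
  refine le_antisymm (hV k) (le_of_not_gt fun hlt => ?_)
  have h := mul_lt_one_of_lt_of_le hlt (hV k⁻¹)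
  rw [← map_mul, ← map_mul, mul_inv_cancel₀ hk, map_one, map_one] at h
  exact lt_irrefl _ h

/-- Opposite roots have equal squares, so `u = v`; as `s` is a function, `2 * s v = 0` follows. Thus
the inverted elements do not vanish at the chosen point. -/
theorem sqrt_add_sqrt_ne_zero (h2 : (2 : K) ≠ 0) (hs : ∀ c : K, s c ^ 2 = c) (u : K) {v : K}
    (hv : v ≠ 0) : s u + s v ≠ 0 := by
  intro h
  have huv : u = v := by
    rw [← hs u, ← hs v, eq_neg_of_add_eq_zero_left h, neg_sq]
  rw [huv, ← two_mul] at h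
  rcases mul_eq_zero.1 h with h | h
  · exact h2 h
  · exact hv (by rw [← hs v, h]; ring)

theorem radical_add_algebraMap_ne_zero
    (hr : ∀ a : K, r a ^ 2 = (closureX K + algebraMap K (RatFuncClosure K) a) ^ 3) (a k : K) :
    r a + algebraMap K (RatFuncClosure K) k ≠ 0 := by
  intro h
  have h1 : Polynomial.aeval (closureX K) ((.X + .C a : K[X]) ^ 3 - .C (k ^ 2)) = 0 := by
    simp only [map_sub, map_pow, map_add, Polynomial.aeval_X, Polynomial.aeval_C, ← hr,
      eq_neg_of_add_eq_zero_left h]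
    ring
  have h0 := transcendental_iff.1 transcendental_closureX _ h1
  have e0 := congrArg (Polynomial.eval (-a)) h0
  have e1 := congrArg (Polynomial.eval (1 - a)) h0
  simp at e0 e1
  simp [e0] at e1

/-- The elements of the field generated by the radicals `√((X + a) ^ 3)` with `a ∈ F` that are
regular at the chosen point over `X = -c`. -/
def regularRing (s : K → K) (r : K → RatFuncClosure K) (c : K) (F : Finset K) :
    Subalgebra K (RatFuncClosure K) where
  carrier := {z | z ∈ IntermediateField.adjoin (RatFunc K) (r '' F) ∧
    ∀ (Γ : Type u) [LinearOrderedCommGroupWithZero Γ] (V : Valuation (RatFuncClosure K) Γ),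
      IsCenteredAt s r c F V → V z ≤ 1}
  mul_mem' hx hy := ⟨mul_mem hx.1 hy.1, fun Γ _ V hV => by
    rw [map_mul]; exact mul_le_one' (hx.2 Γ V hV) (hy.2 Γ V hV)⟩
  add_mem' hx hy := ⟨add_mem hx.1 hy.1, fun Γ _ V hV =>
    V.map_add_le (hx.2 Γ V hV) (hy.2 Γ V hV)⟩
  algebraMap_mem' k := ⟨by
    rw [IsScalarTower.algebraMap_apply K (RatFunc K) (RatFuncClosure K)]
    exact IntermediateField.algebraMap_mem _ _, fun Γ _ V hV => hV.le_one k⟩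

theorem IsCenteredAt.mono {c : K} {F F' : Finset K} (h : F ⊆ F') {Γ : Type*}
    [LinearOrderedCommGroupWithZero Γ] {V : Valuation (RatFuncClosure K) Γ}
    (hV : IsCenteredAt s r c F' V) : IsCenteredAt s r c F V :=
  ⟨hV.le_one, hV.add_lt_one, fun a ha => hV.sub_lt_one a (h ha)⟩

theorem regularRing_mono {c : K} {F F' : Finset K} (h : F ⊆ F') :
    regularRing s r c F ≤ regularRing s r c F' := fun _ hz =>
  ⟨IntermediateField.adjoin.mono _ _ _ (Set.image_mono (Finset.coe_subset.2 h)) hz.1,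
    fun Γ _ V hV => hz.2 Γ V (hV.mono h)⟩

theorem closureX_mem_regularRing (c : K) (F : Finset K) : closureX K ∈ regularRing s r c F := by
  refine ⟨IntermediateField.algebraMap_mem _ _, fun Γ _ V hV => ?_⟩
  have : closureX K = (closureX K + algebraMap K (RatFuncClosure K) c) -
      algebraMap K (RatFuncClosure K) c := by ring
  rw [this]
  exact V.map_sub_le hV.add_lt_one.le (hV.le_one c)

theorem inv_radical_add_mem_regularRing (h2 : (2 : K) ≠ 0) (hs : ∀ c : K, s c ^ 2 = c) (c : K)
    {F : Finset K} {a b : K} (ha : a ∈ F) (hb : b ≠ 0) :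
    (r a + algebraMap K (RatFuncClosure K) (s (b ^ 3)))⁻¹ ∈ regularRing s r c F := by
  refine ⟨inv_mem (add_mem (IntermediateField.subset_adjoin _ _ ⟨a, ha, rfl⟩) ?_),
    fun Γ _ V hV => ?_⟩
  · rw [IsScalarTower.algebraMap_apply K (RatFunc K) (RatFuncClosure K)]
    exact IntermediateField.algebraMap_mem _ _
  · have h1 := Valuation.map_algebraMap_eq_one hV.le_one
      (sqrt_add_sqrt_ne_zero h2 hs ((a - c) ^ 3) (pow_ne_zero 3 hb))
    have e : r a + algebraMap K (RatFuncClosure K) (s (b ^ 3)) =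
        (r a - algebraMap K (RatFuncClosure K) (s ((a - c) ^ 3))) +
          algebraMap K (RatFuncClosure K) (s ((a - c) ^ 3) + s (b ^ 3)) := by
      rw [map_add]; ring
    rw [map_inv₀, e, V.map_add_eq_of_lt_right (h1.symm ▸ hV.sub_lt_one a ha), h1, inv_one]

theorem inv_cube_sub_mem_regularRing {c k : K} (F : Finset K) (hk : k ≠ 0) :
    ((closureX K + algebraMap K (RatFuncClosure K) c) ^ 3 -
      algebraMap K (RatFuncClosure K) k)⁻¹ ∈ regularRing s r c F := by
  have hbase (k : K) : algebraMap K (RatFuncClosure K) k ∈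
      IntermediateField.adjoin (RatFunc K) (r '' F) := by
    rw [IsScalarTower.algebraMap_apply K (RatFunc K) (RatFuncClosure K)]
    exact IntermediateField.algebraMap_mem _ _
  have hX : closureX K ∈ IntermediateField.adjoin (RatFunc K) (r '' F) :=
    IntermediateField.algebraMap_mem _ _
  refine ⟨inv_mem (sub_mem (pow_mem (add_mem hX (hbase c)) 3) (hbase k)), fun Γ _ V hV => ?_⟩
  have h1 := Valuation.map_algebraMap_eq_one hV.le_one hk
  rw [map_inv₀, V.map_sub_eq_of_lt_right, h1, inv_one]
  rw [h1, map_pow]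
  exact pow_lt_one₀ zero_le hV.add_lt_one three_ne_zero

theorem mul_ne_one_of_mem_regularRing (h2 : (2 : K) ≠ 0) (hs : ∀ c : K, s c ^ 2 = c)
    (hr : ∀ a : K, r a ^ 2 = (closureX K + algebraMap K (RatFuncClosure K) a) ^ 3)
    {c : K} {F : Finset K} {v : RatFuncClosure K} (hv : v ∈ regularRing s r c F) :
    (closureX K + algebraMap K (RatFuncClosure K) c) * v ≠ 1 := by
  obtain ⟨Γ, _, V, hV⟩ := exists_isCenteredAt h2 hs hr c F
  intro h
  have := mul_lt_one_of_lt_of_le hV.add_lt_one (hv.2 Γ V hV)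
  rw [← map_mul, h, map_one] at this
  exact lt_irrefl _ this

/-- The subalgebra `S + S e` generated by a subalgebra `S` and a square root `e` of an element
of `S`. -/
def Subalgebra.adjoinSqrt {k L : Type*} [CommRing k] [CommRing L] [Algebra k L]
    (S : Subalgebra k L) (e : L) (he : e ^ 2 ∈ S) : Subalgebra k L where
  carrier := {z | ∃ v ∈ S, ∃ w ∈ S, z = v + w * e}
  add_mem' := by
    rintro _ _ ⟨v, hv, w, hw, rfl⟩ ⟨v', hv', w', hw', rfl⟩
    exact ⟨v + v', add_mem hv hv', w + w', add_mem hw hw', by ring⟩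
  mul_mem' := by
    rintro _ _ ⟨v, hv, w, hw, rfl⟩ ⟨v', hv', w', hw', rfl⟩
    exact ⟨v * v' + w * w' * e ^ 2, add_mem (mul_mem hv hv') (mul_mem (mul_mem hw hw') he),
      v * w' + w * v', add_mem (mul_mem hv hw') (mul_mem hw hv'), by ring⟩
  algebraMap_mem' a := ⟨_, S.algebraMap_mem a, 0, zero_mem _, by ring⟩

theorem Subalgebra.adjoinSqrt_mono {k L : Type*} [CommRing k] [CommRing L] [Algebra k L]
    {S T : Subalgebra k L} (h : S ≤ T) {e : L} (he : e ^ 2 ∈ S) :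
    S.adjoinSqrt e he ≤ T.adjoinSqrt e (h he) := by
  rintro _ ⟨v, hv, w, hw, rfl⟩
  exact ⟨v, h hv, w, h hw, rfl⟩

theorem Subalgebra.le_adjoinSqrt {k L : Type*} [CommRing k] [CommRing L] [Algebra k L]
    (S : Subalgebra k L) {e : L} (he : e ^ 2 ∈ S) : S ≤ S.adjoinSqrt e he :=
  fun v hv => ⟨v, hv, 0, zero_mem _, by ring⟩

/-- The set `F` does not depend on `c`, so that `c` can later be chosen outside it. -/
theorem exists_forall_mem_regularRing (h2 : (2 : K) ≠ 0) (hs : ∀ c : K, s c ^ 2 = c)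
    {y : RatFuncClosure K} (hy : y ∈ radicalRing K s r) :
    ∃ F : Finset K, ∀ c, y ∈ regularRing s r c F := by
  classical
  induction hy using Algebra.adjoin_induction with
  | mem y hy =>
    rcases hy with rfl | ⟨a, b, hb, rfl⟩
    · exact ⟨∅, fun c => closureX_mem_regularRing c ∅⟩
    · exact ⟨{a}, fun c => by
        rw [one_div]
        exact inv_radical_add_mem_regularRing h2 hs c (Finset.mem_singleton_self a) hb⟩
  | algebraMap k => exact ⟨∅, fun c => Subalgebra.algebraMap_mem _ k⟩
  | add y z _ _ hy hz =>
    obtain ⟨F, hF⟩ := hy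
    obtain ⟨F', hF'⟩ := hz
    exact ⟨F ∪ F', fun c => add_mem (regularRing_mono Finset.subset_union_left (hF c))
      (regularRing_mono Finset.subset_union_right (hF' c))⟩
  | mul y z _ _ hy hz =>
    obtain ⟨F, hF⟩ := hy
    obtain ⟨F', hF'⟩ := hz
    exact ⟨F ∪ F', fun c => mul_mem (regularRing_mono Finset.subset_union_left (hF c))
      (regularRing_mono Finset.subset_union_right (hF' c))⟩

theorem closureX_add_pow_mem_regularRing (c : K) (F : Finset K) (n : ℕ) :
    (closureX K + algebraMap K (RatFuncClosure K) c) ^ n ∈ regularRing s r c F :=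
  pow_mem (add_mem (closureX_mem_regularRing c F) (Subalgebra.algebraMap_mem _ c)) n

theorem exists_mem_adjoinSqrt_regularRing (h2 : (2 : K) ≠ 0) (hs : ∀ c : K, s c ^ 2 = c)
    (hr : ∀ a : K, r a ^ 2 = (closureX K + algebraMap K (RatFuncClosure K) a) ^ 3) (c : K)
    {y : RatFuncClosure K} (hy : y ∈ radicalRing K s r) :
    ∃ F : Finset K, c ∉ F ∧ y ∈ (regularRing s r c F).adjoinSqrt (r c)
      (hr c ▸ closureX_add_pow_mem_regularRing c F 3) := by
  classical
  induction hy using Algebra.adjoin_induction with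
  | mem y hy =>
    rcases hy with rfl | ⟨a, b, hb, rfl⟩
    · exact ⟨∅, Finset.notMem_empty c,
        Subalgebra.le_adjoinSqrt _ _ (closureX_mem_regularRing c ∅)⟩
    rw [one_div]
    -- For `a = c` the denominator is rationalized: `(r c + β)⁻¹ = (r c - β) * d⁻¹`, and `d` is a
    -- unit at `X = -c` since its value there is `-b ^ 3`.
    by_cases hac : c = a
    · subst hac
      set β := algebraMap K (RatFuncClosure K) (s (b ^ 3)) with hβ
      have hβ2 : β ^ 2 = algebraMap K (RatFuncClosure K) (b ^ 3) := by rw [hβ, ← map_pow, hs]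
      set d := (closureX K + algebraMap K (RatFuncClosure K) c) ^ 3 -
        algebraMap K (RatFuncClosure K) (b ^ 3) with hd
      have hd' : d⁻¹ ∈ regularRing s r c ∅ := inv_cube_sub_mem_regularRing ∅ (pow_ne_zero 3 hb)
      have hβm : β ∈ regularRing s r c ∅ := Subalgebra.algebraMap_mem _ _
      have hmul : (r c + β) * (r c - β) = d := by
        rw [hd, ← hr, ← hβ2]; ring
      have hne : r c + β ≠ 0 := radical_add_algebraMap_ne_zero hr _ _
      have hne' : r c - β ≠ 0 := by
        rw [sub_eq_add_neg, hβ, ← map_neg]; exact radical_add_algebraMap_ne_zero hr _ _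
      refine ⟨∅, Finset.notMem_empty c, -β * d⁻¹, mul_mem (neg_mem hβm) hd', d⁻¹, hd', ?_⟩
      rw [← hmul]
      field_simp
      ring
    · exact ⟨{a}, by simpa using hac, Subalgebra.le_adjoinSqrt _ _
        (inv_radical_add_mem_regularRing h2 hs c (Finset.mem_singleton_self a) hb)⟩
  | algebraMap k => exact ⟨∅, Finset.notMem_empty c, Subalgebra.algebraMap_mem _ k⟩
  | add y z _ _ hy hz =>
    obtain ⟨F, hc, hF⟩ := hy
    obtain ⟨F', hc', hF'⟩ := hz
    exact ⟨F ∪ F', Finset.notMem_union.2 ⟨hc, hc'⟩, add_mem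
      (Subalgebra.adjoinSqrt_mono (regularRing_mono Finset.subset_union_left) _ hF)
      (Subalgebra.adjoinSqrt_mono (regularRing_mono Finset.subset_union_right) _ hF')⟩
  | mul y z _ _ hy hz =>
    obtain ⟨F, hc, hF⟩ := hy
    obtain ⟨F', hc', hF'⟩ := hz
    exact ⟨F ∪ F', Finset.notMem_union.2 ⟨hc, hc'⟩, mul_mem
      (Subalgebra.adjoinSqrt_mono (regularRing_mono Finset.subset_union_left) _ hF)
      (Subalgebra.adjoinSqrt_mono (regularRing_mono Finset.subset_union_right) _ hF')⟩

theorem eq_zero_of_add_mul_eq_zero {E L : Type*} [Field E] [Field L] [Algebra E L]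
    (M : IntermediateField E L) {ρ v w : L} (hρ : ρ ∉ M) (hv : v ∈ M) (hw : w ∈ M)
    (h : v + w * ρ = 0) : v = 0 ∧ w = 0 := by
  have hw0 : w = 0 := by
    by_contra hw0
    refine hρ ?_
    have : ρ = -v * w⁻¹ := by
      field_simp
      linear_combination h
    rw [this]
    exact mul_mem (neg_mem hv) (inv_mem hw)
  exact ⟨by simpa [hw0] using h, hw0⟩

theorem closureX_mem_radicalRing : closureX K ∈ radicalRing K s r :=
  Algebra.subset_adjoin (Or.inl rfl)

theorem inv_mem_radicalRing (a : K) {b : K} (hb : b ≠ 0) :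
    (r a + algebraMap K (RatFuncClosure K) (s (b ^ 3)))⁻¹ ∈ radicalRing K s r :=
  Algebra.subset_adjoin (Or.inr ⟨a, b, hb, (one_div _).symm⟩)

theorem radical_mem_radicalRing (hs : ∀ c : K, s c ^ 2 = c)
    (hr : ∀ a : K, r a ^ 2 = (closureX K + algebraMap K (RatFuncClosure K) a) ^ 3) (a : K) :
    r a ∈ radicalRing K s r := by
  -- With `b = 1`, the radical is recovered from `r a - β = ((X + a) ^ 3 - 1) / (r a + β)`.
  set β := algebraMap K (RatFuncClosure K) (s (1 ^ 3)) with hβ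
  have hβ2 : β ^ 2 = 1 := by rw [hβ, ← map_pow, hs]; simp
  have hne : r a + β ≠ 0 := radical_add_algebraMap_ne_zero hr _ _
  have h : r a = ((closureX K + algebraMap K (RatFuncClosure K) a) ^ 3 - 1) * (r a + β)⁻¹ + β := by
    rw [← hr, ← hβ2]
    field_simp
    ring
  rw [h]
  exact add_mem (mul_mem (sub_mem (pow_mem (add_mem closureX_mem_radicalRing
    (Subalgebra.algebraMap_mem _ a)) 3) (one_mem _)) (inv_mem_radicalRing a one_ne_zero))
    (Subalgebra.algebraMap_mem _ _)

theorem not_isField_radicalRing (h2 : (2 : K) ≠ 0) (hs : ∀ c : K, s c ^ 2 = c)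
    (hr : ∀ a : K, r a ^ 2 = (closureX K + algebraMap K (RatFuncClosure K) a) ^ 3) :
    ¬ IsField (radicalRing K s r) := by
  intro hfield
  have hne := closureX_add_ne_zero (0 : K)
  obtain ⟨⟨z, hz⟩, hz1⟩ := hfield.mul_inv_cancel
    (a := ⟨_, add_mem closureX_mem_radicalRing (Subalgebra.algebraMap_mem _ (0 : K))⟩)
    (fun h => hne (congrArg Subtype.val h))
  have hz1 : (closureX K + algebraMap K (RatFuncClosure K) 0) * z = 1 := congrArg Subtype.val hz1
  obtain ⟨F, hc, v, hv, w, hw, rfl⟩ := exists_mem_adjoinSqrt_regularRing h2 hs hr 0 hz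
  set t := closureX K + algebraMap K (RatFuncClosure K) 0 with ht
  have htm : t ∈ regularRing s r 0 F := by
    rw [← pow_one t]; exact closureX_add_pow_mem_regularRing 0 F 1
  obtain ⟨h1, -⟩ := eq_zero_of_add_mul_eq_zero _ (sqrt_notMem_adjoin h2 hr hc)
    (sub_mem (mul_mem htm hv) (one_mem _)).1 (mul_mem htm hw).1
    (show t * v - 1 + t * w * r 0 = 0 by linear_combination hz1)
  exact mul_ne_one_of_mem_regularRing h2 hs hr hv (sub_eq_zero.1 h1)

theorem RingHom.Finite.exists_finset_induction {A B : Type*} [CommRing A] [CommRing B]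
    {f : A →+* B} (hf : f.Finite) :
    ∃ S : Finset B, ∀ Q : B → Prop, Q 0 → (∀ y ∈ S, Q y) → (∀ y z, Q y → Q z → Q (y + z)) →
      (∀ a y, Q y → Q (f a * y)) → ∀ z, Q z := by
  algebraize [f]
  obtain ⟨S, hS⟩ := Module.Finite.fg_top (R := A) (M := B)
  refine ⟨S, fun Q h0 hmem hadd hsmul z => ?_⟩
  have hz : z ∈ Submodule.span A (S : Set B) := hS ▸ Submodule.mem_top
  induction hz using Submodule.span_induction with
  | mem y hy => exact hmem y hy
  | zero => exact h0
  | add y z _ _ hy hz => exact hadd y z hy hz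
  | smul a y _ hy => rw [Algebra.smul_def]; exact hsmul a y hy

theorem not_isFFinite_radicalRing (p : ℕ) [Fact p.Prime] (hp : Odd p) [CharP K p] [Infinite K]
    (h2 : (2 : K) ≠ 0) (hs : ∀ c : K, s c ^ 2 = c)
    (hr : ∀ a : K, r a ^ 2 = (closureX K + algebraMap K (RatFuncClosure K) a) ^ 3) :
    ¬ IsFFinite p (radicalRing K s r) := by
  classical
  intro hfin
  have : CharP (RatFuncClosure K) p := charP_of_injective_algebraMap
    (algebraMap K (RatFuncClosure K)).injective p
  obtain ⟨m, hm⟩ := hp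
  have hm1 : m ≠ 0 := by
    rintro rfl
    exact (Fact.out : p.Prime).one_lt.ne' (by omega)
  obtain ⟨S, hS⟩ := hfin.exists_finset_induction
  choose f hf using fun y : radicalRing K s r => exists_forall_mem_regularRing h2 hs y.2
  obtain ⟨c, hc⟩ := Infinite.exists_notMem_finset (S.biUnion f)
  set t := closureX K + algebraMap K (RatFuncClosure K) c with ht
  have htm (F : Finset K) (n : ℕ) : t ^ n ∈ regularRing s r c F :=
    closureX_add_pow_mem_regularRing c F n
  -- This is `(r c) ^ p`, because `p = 2 * m + 1` and `(r c) ^ 2 = t ^ 3`.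
  set e := t ^ (3 * m) * r c with he
  have he2 (F : Finset K) : e ^ 2 ∈ regularRing s r c F := by
    have : e ^ 2 = t ^ (3 * m * 2 + 3) := by rw [he, mul_pow, hr]; ring
    rw [this]
    exact htm F _
  have hpow {F : Finset K} {z : RatFuncClosure K}
      (hz : z ∈ (regularRing s r c F).adjoinSqrt (r c) (hr c ▸ htm F 3)) :
      z ^ p ∈ (regularRing s r c F).adjoinSqrt e (he2 F) := by
    obtain ⟨v, hv, w, hw, rfl⟩ := hz
    refine ⟨v ^ p, pow_mem hv p, w ^ p, pow_mem hw p, ?_⟩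
    have : r c ^ p = e := by
      rw [hm, pow_succ, pow_mul, hr, he, ← pow_mul]
    rw [add_pow_char, mul_pow, this]
  obtain ⟨F, hcF, v, hv, w, hw, hvw⟩ := hS (fun z => ∃ F : Finset K, c ∉ F ∧
      (z : RatFuncClosure K) ∈ (regularRing s r c F).adjoinSqrt e (he2 F))
    ⟨∅, Finset.notMem_empty c, zero_mem _⟩
    (fun y hy => ⟨f y, fun h => hc (Finset.mem_biUnion.2 ⟨y, hy, h⟩),
      Subalgebra.le_adjoinSqrt _ _ (hf y c)⟩)
    (fun y z hy hz => by
      obtain ⟨F, hc, hF⟩ := hy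
      obtain ⟨F', hc', hF'⟩ := hz
      exact ⟨F ∪ F', Finset.notMem_union.2 ⟨hc, hc'⟩, add_mem
        (Subalgebra.adjoinSqrt_mono (regularRing_mono Finset.subset_union_left) _ hF)
        (Subalgebra.adjoinSqrt_mono (regularRing_mono Finset.subset_union_right) _ hF')⟩)
    (fun a z hz => by
      obtain ⟨F, hc, hF⟩ := exists_mem_adjoinSqrt_regularRing h2 hs hr c a.2
      obtain ⟨F', hc', hF'⟩ := hz
      exact ⟨F ∪ F', Finset.notMem_union.2 ⟨hc, hc'⟩, mul_mem
        (Subalgebra.adjoinSqrt_mono (regularRing_mono Finset.subset_union_left) _ (hpow hF))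
        (Subalgebra.adjoinSqrt_mono (regularRing_mono Finset.subset_union_right) _ hF')⟩)
    ⟨r c, radical_mem_radicalRing hs hr c⟩
  have hvw : r c = v + w * e := hvw
  obtain ⟨-, h1⟩ := eq_zero_of_add_mul_eq_zero _ (sqrt_notMem_adjoin h2 hr hcF) hv.1
    (sub_mem (mul_mem hw (htm F (3 * m))) (one_mem _)).1
    (show v + (w * t ^ (3 * m) - 1) * r c = 0 by rw [he] at hvw; linear_combination -hvw)
  -- One factor `t` is split off `w * t ^ (3 * m) = 1`, which needs `m ≠ 0`.
  refine mul_ne_one_of_mem_regularRing h2 hs hr (mul_mem hw (htm F (3 * m - 1))) ?_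
  rw [← ht, ← sub_eq_zero, ← h1]
  obtain ⟨n, hn⟩ : ∃ n, 3 * m = n + 1 := ⟨3 * m - 1, by omega⟩
  rw [hn, Nat.add_sub_cancel]
  ring

end Center

/-! ### Primes and localizations -/

/-- Finiteness of the Frobenius endomorphism, by finitely many elements that generate the ring
over its subring of `p`-th powers. -/
theorem frobenius_finite_of_forall_subring {p : ℕ} [Fact p.Prime] {R : Type*} [CommRing R]
    [CharP R p] (S : Finset R)
    (h : ∀ T : Subring R, (∀ y : R, y ^ p ∈ T) → (S : Set R) ⊆ T → T = ⊤) :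
    (frobenius R p).Finite := by
  refine RingHom.IsIntegral.to_finite (fun y => ?_) ?_
  · refine ⟨(Polynomial.X ^ p - Polynomial.C y : R[X]),
      Polynomial.monic_X_pow_sub_C y (Fact.out : p.Prime).ne_zero, ?_⟩
    rw [Polynomial.eval₂_sub, Polynomial.eval₂_X_pow, Polynomial.eval₂_C, frobenius_def, sub_self]
  · let alg := (frobenius R p).toAlgebra
    refine ⟨S, ?_⟩
    have hT := h (@Algebra.adjoin R R _ _ alg (S : Set R)).toSubring
      (fun y => @Subalgebra.algebraMap_mem R R _ _ alg _ y) Algebra.subset_adjoin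
    exact SetLike.ext fun z => (SetLike.ext_iff.1 hT z)

/-- The properties of `radicalRing K s r` that hold before the radicals are known to be
independent. -/
structure IsRadicalAlgebra {K : Type*} [Field K] (s : K → K) {A : Type*} [CommRing A] [Algebra K A]
    (t : A) (ρ : K → A) : Prop where
  sq_eq (a : K) : ρ a ^ 2 = (t + algebraMap K A a) ^ 3
  isUnit (a b : K) : b ≠ 0 → IsUnit (ρ a + algebraMap K A (s (b ^ 3)))
  eq_top (T : Subalgebra K A) : t ∈ T →
    (∀ a b z, b ≠ 0 → z * (ρ a + algebraMap K A (s (b ^ 3))) = 1 → z ∈ T) → T = ⊤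
  exists_aeval_mem (P : Ideal A) : P.IsPrime → P ≠ ⊥ → ∃ q : K[X], q ≠ 0 ∧ q.aeval t ∈ P

namespace IsRadicalAlgebra

variable {K : Type*} [Field K] {s : K → K} {A : Type*} [CommRing A] [Algebra K A]
  {t : A} {ρ : K → A}

theorem exists_add_mem [IsAlgClosed K] (hA : IsRadicalAlgebra s t ρ) (P : Ideal A) [hP : P.IsPrime]
    (h : P ≠ ⊥) : ∃ c : K, t + algebraMap K A c ∈ P := by
  obtain ⟨q, hq0, hq⟩ := hA.exists_aeval_mem P hP h
  rw [(IsAlgClosed.splits q).eq_prod_roots, map_mul, Polynomial.aeval_C, map_multiset_prod] at hq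
  rcases hP.mem_or_mem hq with hq | hq
  · exact absurd (Ideal.eq_top_of_isUnit_mem _ hq
      ((Polynomial.leadingCoeff_ne_zero.2 hq0).isUnit.map _)) hP.ne_top
  · obtain ⟨_, hz, hzP⟩ := (hP.multiset_prod_mem_iff_exists_mem _).1 hq
    simp only [Multiset.map_map, Multiset.mem_map, Function.comp] at hz
    obtain ⟨c, -, rfl⟩ := hz
    exact ⟨-c, by simpa [sub_eq_add_neg] using hzP⟩

/-- Modulo `X + c` and `√((X + c) ^ 3)` every element is constant. -/
theorem exists_sub_algebraMap_mem (hA : IsRadicalAlgebra s t ρ) (h2 : (2 : K) ≠ 0)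
    (hs : ∀ c : K, s c ^ 2 = c) (c : K) (y : A) :
    ∃ k : K, y - algebraMap K A k ∈ Ideal.span {t + algebraMap K A c, ρ c} := by
  set I := Ideal.span {t + algebraMap K A c, ρ c} with hI
  let T : Subalgebra K A := (⊥ : Subalgebra K (A ⧸ I)).comap (Ideal.Quotient.mkₐ K I)
  have hT {y : A} : y ∈ T ↔ ∃ k : K, y - algebraMap K A k ∈ I := by
    change Ideal.Quotient.mk I y ∈ (⊥ : Subalgebra K (A ⧸ I)) ↔ _
    rw [Algebra.mem_bot, Set.mem_range]
    refine exists_congr fun k => ?_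
    rw [← Ideal.Quotient.mk_eq_mk_iff_sub_mem, eq_comm]
    rfl
  have ht : t + algebraMap K A c ∈ I := Ideal.subset_span (by simp)
  have hρc : ρ c ∈ I := Ideal.subset_span (by simp)
  have hρ (a : K) : ρ a - algebraMap K A (s ((a - c) ^ 3)) ∈ I := by
    -- For `a ≠ c` the factor with the plus sign is a unit, and the product of both factors is `(t +
    -- a) ^ 3 - (a - c) ^ 3`, a multiple of `t + c`.
    by_cases hac : a = c
    · have : s ((a - c) ^ 3) = 0 := by
        have := hs ((a - c) ^ 3)
        rw [hac, sub_self] at this ⊢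
        simpa using this
      rw [this, map_zero, sub_zero, hac]
      exact hρc
    · obtain ⟨u, hu⟩ := hA.isUnit a (a - c) (sub_ne_zero.2 hac)
      rw [← Ideal.mul_unit_mem_iff_mem I u.isUnit, hu]
      have h1 : algebraMap K A (s ((a - c) ^ 3)) ^ 2 = (algebraMap K A a - algebraMap K A c) ^ 3 := by
        rw [← map_pow, hs, map_pow, map_sub]
      have e : (ρ a - algebraMap K A (s ((a - c) ^ 3))) * (ρ a + algebraMap K A (s ((a - c) ^ 3))) =
          ((t + algebraMap K A a) ^ 2 + (t + algebraMap K A a) *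
            (algebraMap K A a - algebraMap K A c) + (algebraMap K A a - algebraMap K A c) ^ 2) *
            (t + algebraMap K A c) := by
        linear_combination hA.sq_eq a - h1
      rw [e]
      exact I.mul_mem_left _ ht
  have htop : T = ⊤ := by
    refine hA.eq_top T (hT.2 ⟨-c, by simpa using ht⟩) fun a b z hb hz => hT.2 ?_
    set k := s ((a - c) ^ 3) + s (b ^ 3) with hk
    have hk0 : k ≠ 0 := sqrt_add_sqrt_ne_zero h2 hs _ (pow_ne_zero 3 hb)
    have h1 : algebraMap K A k * algebraMap K A k⁻¹ = 1 := by
      rw [← map_mul, mul_inv_cancel₀ hk0, map_one]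
    refine ⟨k⁻¹, ?_⟩
    have e : z - algebraMap K A k⁻¹ =
        -(z * algebraMap K A k⁻¹) * (ρ a - algebraMap K A (s ((a - c) ^ 3))) := by
      rw [hk, map_add] at h1
      linear_combination (algebraMap K A k⁻¹) * hz - z * h1
    rw [e]
    exact I.mul_mem_left _ (hρ a)
  exact hT.1 (htop ▸ Algebra.mem_top)

theorem eq_span (hA : IsRadicalAlgebra s t ρ) (h2 : (2 : K) ≠ 0)
    (hs : ∀ c : K, s c ^ 2 = c) {P : Ideal A} [hP : P.IsPrime] {c : K}
    (hc : t + algebraMap K A c ∈ P) : P = Ideal.span {t + algebraMap K A c, ρ c} := by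
  have hle : Ideal.span {t + algebraMap K A c, ρ c} ≤ P := by
    rw [Ideal.span_le]
    rintro y (rfl | rfl)
    · exact hc
    · refine hP.mem_of_pow_mem 2 ?_
      rw [hA.sq_eq]
      exact P.pow_mem_of_mem hc 3 three_pos
  refine le_antisymm (fun y hy => ?_) hle
  obtain ⟨k, hk⟩ := hA.exists_sub_algebraMap_mem h2 hs c y
  have hkP : algebraMap K A k ∈ P := by
    have := sub_mem hy (hle hk)
    rwa [sub_sub_cancel] at this
  have hk0 : k = 0 := by
    by_contra hk0
    exact hP.ne_top (Ideal.eq_top_of_isUnit_mem _ hkP ((isUnit_iff_ne_zero.2 hk0).map _))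
  simpa [hk0] using hk

theorem isNoetherianRing [IsAlgClosed K] (hA : IsRadicalAlgebra s t ρ) (h2 : (2 : K) ≠ 0)
    (hs : ∀ c : K, s c ^ 2 = c) : IsNoetherianRing A := by
  refine IsNoetherianRing.of_prime_ne_bot fun P hP hbot => ?_
  obtain ⟨c, hc⟩ := hA.exists_add_mem P hbot
  rw [hA.eq_span h2 hs hc]
  exact Submodule.fg_span (Set.toFinite _)

theorem krullDimLE_one [IsAlgClosed K] (hA : IsRadicalAlgebra s t ρ) (h2 : (2 : K) ≠ 0)
    (hs : ∀ c : K, s c ^ 2 = c) : Ring.KrullDimLE 1 A := by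
  refine Ring.KrullDimLE.mk₁' fun P hbot hP => ?_
  obtain ⟨c, hc⟩ := hA.exists_add_mem P hbot
  obtain ⟨M, hM, hPM⟩ := P.exists_le_maximal hP.ne_top
  have := hM.isPrime
  rwa [hA.eq_span h2 hs hc, ← hA.eq_span h2 hs (hPM hc)]

theorem isFFinite_localization [IsAlgClosed K] (hA : IsRadicalAlgebra s t ρ) (p : ℕ)
    [Fact p.Prime] (hp : Odd p) [CharP A p] [CharP K p] (P : Ideal A) [hP : P.IsPrime] :
    IsFFinite p (Localization.AtPrime P) := by
  classical
  obtain ⟨m, hm⟩ := hp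
  -- Two such elements differ by a unit, so at most one lies in `P`; if none does, `0` serves as a
  -- dummy.
  obtain ⟨c, hc⟩ : ∃ c : K, ∀ a ≠ c, t + algebraMap K A a ∉ P := by
    by_cases h : ∃ c : K, t + algebraMap K A c ∈ P
    · obtain ⟨c, hc⟩ := h
      refine ⟨c, fun a hac ha => hP.ne_top (Ideal.eq_top_of_isUnit_mem _ (sub_mem ha hc) ?_)⟩
      rw [add_sub_add_left_eq_sub, ← map_sub]
      exact (sub_ne_zero.2 hac).isUnit.map _
    · exact ⟨0, fun a _ ha => h ⟨a, ha⟩⟩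
  set f := algebraMap A (Localization.AtPrime P) with hf
  refine frobenius_finite_of_forall_subring {f t, f (ρ c)} fun T hpow hT => ?_
  -- A ring containing all `p`-th powers is closed under inverses: `u⁻¹ = u ^ (p - 1) * (u⁻¹) ^ p`.
  have hinv {u v : Localization.AtPrime P} (hu : u ∈ T) (huv : v * u = 1) : v ∈ T := by
    have e : v = u ^ (2 * m) * v ^ p := by
      rw [hm, pow_succ, ← mul_assoc, ← mul_pow, mul_comm u, huv, one_pow, one_mul]
    rw [e]
    exact mul_mem (pow_mem hu _) (hpow v)
  have hK (k : K) : f (algebraMap K A k) ∈ T := by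
    obtain ⟨l, rfl⟩ := IsAlgClosed.exists_pow_nat_eq k (Fact.out : p.Prime).pos
    rw [map_pow, map_pow]
    exact hpow _
  have ht : f t ∈ T := hT (by simp)
  have hρ (a : K) : f (ρ a) ∈ T := by
    by_cases hac : a = c
    · rw [hac]; exact hT (by simp)
    · have hu : IsUnit (f (t + algebraMap K A a)) :=
        IsLocalization.map_units (Localization.AtPrime P) (⟨_, hc a hac⟩ : P.primeCompl)
      obtain ⟨v, hv⟩ := hu.exists_left_inv
      have hvT : v ∈ T := hinv (by rw [map_add]; exact add_mem ht (hK a)) hv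
      have e : f (ρ a) = f (ρ a) ^ p * v ^ (3 * m) := by
        have h3 : f (ρ a) ^ 2 = f (t + algebraMap K A a) ^ 3 := by
          rw [← map_pow, hA.sq_eq, map_pow]
        rw [hm, pow_succ, pow_mul, h3, ← pow_mul, mul_right_comm, ← mul_pow, mul_comm _ v, hv,
          one_pow, one_mul]
      rw [e]
      exact mul_mem (hpow _) (pow_mem hvT _)
  let TA : Subalgebra K A := { T.comap f with algebraMap_mem' := hK }
  have hTA : TA = ⊤ := hA.eq_top TA ht fun a b z _ hz => by
    refine hinv (u := f (ρ a + algebraMap K A (s (b ^ 3)))) ?_ (by rw [← map_mul, hz, map_one])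
    rw [map_add]
    exact add_mem (hρ a) (hK _)
  have hfT (y : A) : f y ∈ T := (hTA ▸ Algebra.mem_top : y ∈ TA)
  refine eq_top_iff.2 fun z _ => ?_
  obtain ⟨y, w, rfl⟩ := IsLocalization.exists_mk'_eq P.primeCompl z
  obtain ⟨v, hv⟩ := (IsLocalization.map_units (Localization.AtPrime P) w).exists_left_inv
  have e : IsLocalization.mk' (Localization.AtPrime P) y w = f y * v := by
    rw [IsLocalization.mk'_eq_iff_eq_mul, mul_assoc, hv, mul_one]
  rw [e]
  exact mul_mem (hfT y) (hinv (hfT w) hv)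

end IsRadicalAlgebra

theorem isAlgebraic_polynomial_ratFuncClosure (K : Type u) [Field K] (y : RatFuncClosure K) :
    IsAlgebraic K[X] y :=
  have : Algebra.IsAlgebraic K[X] (RatFuncClosure K) :=
    IsFractionRing.comap_isAlgebraic_iff (K := RatFunc K).2 inferInstance
  Algebra.IsAlgebraic.isAlgebraic y

theorem isRadicalAlgebra_radicalRing {K : Type u} [Field K] {s : K → K} {r : K → RatFuncClosure K}
    (hs : ∀ c : K, s c ^ 2 = c)
    (hr : ∀ a : K, r a ^ 2 = (closureX K + algebraMap K (RatFuncClosure K) a) ^ 3) :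
    IsRadicalAlgebra s (⟨closureX K, closureX_mem_radicalRing⟩ : radicalRing K s r)
      (fun a => ⟨r a, radical_mem_radicalRing hs hr a⟩) where
  sq_eq a := Subtype.ext (hr a)
  isUnit a b hb := IsUnit.of_mul_eq_one ⟨_, inv_mem_radicalRing a hb⟩
    (Subtype.ext (mul_inv_cancel₀ (radical_add_algebraMap_ne_zero hr a _)))
  eq_top T ht hT := by
    have hle : radicalRing K s r ≤ T.map (radicalRing K s r).val := by
      refine Algebra.adjoin_le ?_
      rintro y (rfl | ⟨a, b, hb, rfl⟩)
      · exact ⟨_, ht, rfl⟩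
      · refine ⟨⟨_, inv_mem_radicalRing a hb⟩, hT a b _ hb (Subtype.ext ?_), (one_div _).symm⟩
        exact inv_mul_cancel₀ (radical_add_algebraMap_ne_zero hr a _)
    refine eq_top_iff.2 fun y _ => ?_
    obtain ⟨z, hz, hzy⟩ := hle y.2
    exact (Subtype.ext hzy : z = y) ▸ hz
  exists_aeval_mem P _ hP := by
    set t : radicalRing K s r := ⟨closureX K, closureX_mem_radicalRing⟩ with ht
    let _ : Algebra K[X] (radicalRing K s r) := (Polynomial.aeval (R := K) t).toAlgebra
    have htower : IsScalarTower K[X] (radicalRing K s r) (RatFuncClosure K) := by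
      refine .of_algebraMap_eq fun q => ?_
      change _ = (radicalRing K s r).val (Polynomial.aeval t q)
      rw [← Polynomial.aeval_algHom_apply]
      change _ = Polynomial.aeval (closureX K) q
      rw [IsScalarTower.algebraMap_apply K[X] (RatFunc K) (RatFuncClosure K), closureX,
        Polynomial.aeval_algebraMap_apply, ← RatFunc.algebraMap_X,
        Polynomial.aeval_algebraMap_apply, Polynomial.aeval_X_left_apply]
    obtain ⟨y, hyP, hy0⟩ := P.ne_bot_iff.1 hP
    have hy : IsAlgebraic K[X] y :=
      (isAlgebraic_algebraMap_iff (A := RatFuncClosure K) Subtype.val_injective).1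
        (isAlgebraic_polynomial_ratFuncClosure K _)
    obtain ⟨q, hq, hq0⟩ := (Submodule.ne_bot_iff _).1
      (Ideal.comap_ne_bot_of_algebraic_mem hy0 hyP hy)
    -- `P` meets `K[X]` nontrivially because it contains a nonzero element algebraic over `K[X]`.
    exact ⟨q, hq0, hq⟩

theorem theorem2p6 (p : ℕ) [Fact p.Prime] (hp : Odd p) :
    (∀ (K : Type u) [Field K] [IsAlgClosed K] [CharP K p]
        (s : K → K) (_ : ∀ c : K, s c ^ 2 = c)
        (r : K → RatFuncClosure K)
        (_ : ∀ a : K, r a ^ 2 = (closureX K + algebraMap K (RatFuncClosure K) a) ^ 3),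
      IsDomain (radicalRing K s r) ∧
      IsNoetherianRing (radicalRing K s r) ∧
      ringKrullDim (radicalRing K s r) = 1 ∧
      (∀ (P : Ideal (radicalRing K s r)) [P.IsPrime], IsFFinite p (Localization.AtPrime P)) ∧
      ¬ IsFFinite p (radicalRing K s r)) ∧
    ¬ DattaMurayamaAssertion.{u} p := by
  have main (K : Type u) [Field K] [IsAlgClosed K] [CharP K p]
      (s : K → K) (hs : ∀ c : K, s c ^ 2 = c) (r : K → RatFuncClosure K)
      (hr : ∀ a : K, r a ^ 2 = (closureX K + algebraMap K (RatFuncClosure K) a) ^ 3) :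
      IsDomain (radicalRing K s r) ∧
      IsNoetherianRing (radicalRing K s r) ∧
      ringKrullDim (radicalRing K s r) = 1 ∧
      (∀ (P : Ideal (radicalRing K s r)) [P.IsPrime], IsFFinite p (Localization.AtPrime P)) ∧
      ¬ IsFFinite p (radicalRing K s r) := by
    have h2 : (2 : K) ≠ 0 := Ring.two_ne_zero (by
      rw [ringChar.eq K p]
      rintro rfl
      exact absurd hp (by decide))
    have hA := isRadicalAlgebra_radicalRing hs hr
    refine ⟨inferInstance, hA.isNoetherianRing h2 hs, ?_,
      fun P _ => hA.isFFinite_localization p hp P, not_isFFinite_radicalRing p hp h2 hs hr⟩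
    have hpos : ¬ ringKrullDim (radicalRing K s r) ≤ 0 := fun h => by
      have : Ring.KrullDimLE 0 (radicalRing K s r) := Ring.krullDimLE_iff.2 h
      exact not_isField_radicalRing h2 hs hr Ring.KrullDimLE.isField_of_isDomain
    exact le_antisymm (Ring.krullDimLE_iff.1 (hA.krullDimLE_one h2 hs))
      (Order.succ_le_of_lt (lt_of_not_ge hpos))
  refine ⟨main, fun hDM => ?_⟩
  -- The lift places the counterexample in the universe of the assertion.
  let k := ULift.{u} (ZMod p)
  have : CharP (AlgebraicClosure k) p := charP_of_injective_algebraMap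
    (algebraMap k (AlgebraicClosure k)).injective p
  choose s hs using fun c : AlgebraicClosure k => IsAlgClosed.exists_pow_nat_eq c two_pos
  choose r hr using fun a : AlgebraicClosure k => IsAlgClosed.exists_pow_nat_eq
    ((closureX _ + algebraMap _ (RatFuncClosure (AlgebraicClosure k)) a) ^ 3) two_pos
  obtain ⟨_, _, -, hloc, hnot⟩ := main (AlgebraicClosure k) s hs r hr
  exact hnot (hDM _ hloc)
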